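/- Let $p$ be a prime, let $\mathbb{F}_q$ be a finite field of characteristic $p$, and let $K$ be a separable algebraic (possibly infinite) extension of the rational function field $\mathbb{F}_q(t)$, equipped with the unique derivation $f\mapsto f'$ extending $\frac{\mathrm d}{\mathrm dt}$. Let $K\langle\partial\rangle$ be the ring of differential operators $\sum_i f_i\partial^i$ ($f_i\in K$), with multiplication determined by $\partial f=f\partial+f'$ for $f\in K$. For $L\in K\langle\partial\rangle$ put $\mathcal{D}_L=K\langle\partial\rangle/K\langle\partial\rangle L$. Call $L$ decomposable if there are $L_1,L_2\in K\langle\partial\rangle\setminus K$ with $K\langle\partial\rangle L_1+K\langle\partial\rangle L_2=K\langle\partial\rangle$ and $K\langle\partial\rangle L=K\langle\partial\rangle L_1\cap K\langle\partial\rangle L_2$ (that is, $L_1,L_2$ are coprime and $L=\mathrm{LCLM}(L_1,L_2)$), and indecomposable otherwise. The $p$-curvature of $L$ is the $K$-linear endomorphism $\psi_p^L$ of $\mathcal{D}_L$ given by multiplication by $\partial^p$. Then for every integer $n\ge 0$ the operator $L=(t\partial)^n$ is indecomposable in $K\langle\partial\rangle$, and its $p$-curvature is a single nilpotent Jordan block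 of size $n$: there is a $K$-basis of $\mathcal{D}_L$, with $n$ elements, in which the matrix of $\psi_p^L$ is the $n\times n$ Jordan block with eigenvalue $0$. -/

import Mathlib

open Polynomial TensorProduct

noncomputable section

/-! ### Extending derivations along formally étale algebras -/

/-- The unique extension of a derivation `d : A → B` to a derivation of a formally étale
`A`-algebra `B`. -/
def etaleExtend (A B : Type*) [CommRing A] [CommRing B] [Algebra A B] [Algebra.FormallyEtale A B]
    (d : Derivation ℤ A B) : Derivation ℤ B B :=
  (((d.liftKaehlerDifferential.liftBaseChange B).comp
    (KaehlerDifferential.tensorKaehlerEquivOfFormallyEtale ℤ A B).symm.toLinearMap)).compDer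
      (KaehlerDifferential.D ℤ B)

theorem etaleExtend_algebraMap {A B : Type*} [CommRing A] [CommRing B] [Algebra A B]
    [Algebra.FormallyEtale A B] (d : Derivation ℤ A B) (a : A) :
    etaleExtend A B d (algebraMap A B a) = d a := by
  change (d.liftKaehlerDifferential.liftBaseChange B)
    ((KaehlerDifferential.tensorKaehlerEquivOfFormallyEtale ℤ A B).symm
      (KaehlerDifferential.D ℤ B (algebraMap A B a))) = d a
  rw [KaehlerDifferential.tensorKaehlerEquivOfFormallyEtale_symm_D_algebraMap,
    LinearMap.liftBaseChange_tmul, one_smul, Derivation.liftKaehlerDifferential_comp_D]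

/-- A derivation of a formally unramified algebra which vanishes on the base is zero. -/
theorem derivation_eq_zero {A B : Type*} [CommRing A] [CommRing B] [Algebra A B]
    [Algebra.FormallyUnramified A B] (D : Derivation ℤ B B)
    (h : ∀ a, D (algebraMap A B a) = 0) (b : B) : D b = 0 := by
  let E : Derivation A B B := Derivation.mk'
    { toFun := D
      map_add' := map_add D
      map_smul' := fun a b => by
        rw [Algebra.smul_def, Derivation.leibniz, h, smul_zero, add_zero, smul_eq_mul,
          RingHom.id_apply, Algebra.smul_def] } (fun a b => D.leibniz a b)
  have hE : E b = 0 := by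
    rw [← E.liftKaehlerDifferential_comp_D, Subsingleton.elim (KaehlerDifferential.D A B b) 0,
      map_zero]
  exact hE

/-! ### The derivation `d/dt` on separable extensions of `F(t)` -/

section ddt

variable (F K : Type*) [Field F] [Field K] [Algebra (RatFunc F) K]

/-- A field extension of `F(t)`, regarded as an algebra over `F[t]`. -/
abbrev polyAlgebra : Algebra F[X] K :=
  ((algebraMap (RatFunc F) K).comp (algebraMap F[X] (RatFunc F))).toAlgebra

theorem formallyEtale_poly [Algebra.IsSeparable (RatFunc F) K] :
    letI := polyAlgebra F K
    Algebra.FormallyEtale F[X] K := by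
  let := polyAlgebra F K
  have : IsScalarTower F[X] (RatFunc F) K := IsScalarTower.of_algebraMap_eq fun _ => rfl
  have : Algebra.FormallyEtale F[X] (RatFunc F) :=
    Algebra.FormallyEtale.of_isLocalization (nonZeroDivisors F[X])
  have : Algebra.FormallyEtale (RatFunc F) K := Algebra.FormallyEtale.of_isSeparable _ _
  exact Algebra.FormallyEtale.comp F[X] (RatFunc F) K

variable [Algebra.IsSeparable (RatFunc F) K]

/-- The derivation on a separable algebraic extension `K` of `F(t)` which extends the
derivation `d/dt` of polynomials in `t`, hence also that of rational functions. -/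
def ddt : Derivation ℤ K K :=
  let := polyAlgebra F K
  haveI := formallyEtale_poly F K
  etaleExtend F[X] K
    ((Algebra.linearMap F[X] K).compDer ((derivative' (R := F)).restrictScalars ℤ))

theorem ddt_poly (f : F[X]) :
    ddt F K (algebraMap (RatFunc F) K (algebraMap F[X] (RatFunc F) f)) =
      algebraMap (RatFunc F) K (algebraMap F[X] (RatFunc F) (derivative f)) :=
  let := polyAlgebra F K
  haveI := formallyEtale_poly F K
  etaleExtend_algebraMap (A := F[X]) (B := K) _ f

variable {F K}

/-- `ddt F K` is the only derivation of `K` extending `d/dt`. -/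
theorem ddt_unique (D : Derivation ℤ K K)
    (h : ∀ f : F[X], D (algebraMap (RatFunc F) K (algebraMap F[X] (RatFunc F) f)) =
      algebraMap (RatFunc F) K (algebraMap F[X] (RatFunc F) (derivative f))) :
    D = ddt F K := by
  let := polyAlgebra F K
  have := formallyEtale_poly F K
  ext x
  refine sub_eq_zero.1 (derivation_eq_zero (A := F[X]) (D - ddt F K) (fun f => ?_) x)
  exact sub_eq_zero.2 ((h f).trans (ddt_poly F K f).symm)

/-- A derivation of `K` that vanishes on `F` and at `t` is zero. -/
theorem derivation_eq_zero_of_sep (D : Derivation ℤ K K)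
    (hC : ∀ a : F, D (algebraMap (RatFunc F) K (RatFunc.C a)) = 0)
    (hX : D (algebraMap (RatFunc F) K RatFunc.X) = 0) (f : K) : D f = 0 := by
  let := polyAlgebra F K
  have := formallyEtale_poly F K
  refine derivation_eq_zero (A := F[X]) D (fun P => ?_) f
  change D (algebraMap (RatFunc F) K (algebraMap F[X] (RatFunc F) P)) = 0
  induction P using Polynomial.induction_on' with
  | add p q hp hq => simp [hp, hq]
  | monomial n a =>
    rw [← C_mul_X_pow_eq_monomial]
    simp [Derivation.leibniz_pow, hC, hX]

theorem ddt_C (a : F) : ddt F K (algebraMap (RatFunc F) K (RatFunc.C a)) = 0 := by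
  rw [← RatFunc.algebraMap_C, ddt_poly]
  simp

theorem ddt_X : ddt F K (algebraMap (RatFunc F) K RatFunc.X) = 1 := by
  rw [← RatFunc.algebraMap_X, ddt_poly]
  simp

end ddt

/-! ### The ring `K⟨∂⟩` of differential operators -/

/-- The ring `K⟨∂⟩` of linear differential operators over the field `K` with derivation `δ`.
As an additive group (and a left `K`-vector space) it consists of the polynomials
`∑ fᵢ ∂ⁱ` in `∂` with coefficients written on the left; multiplication is defined below. -/
def DiffOp {K : Type*} [Field K] (_δ : Derivation ℤ K K) : Type _ := K[X]

namespace DiffOp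

variable {K : Type*} [Field K] {δ : Derivation ℤ K K}

instance : AddCommGroup (DiffOp δ) := inferInstanceAs (AddCommGroup K[X])
instance : Module K (DiffOp δ) := inferInstanceAs (Module K K[X])

/-- The operator `f ∂ⁱ`. -/
def mono (δ : Derivation ℤ K K) (i : ℕ) (f : K) : DiffOp δ := monomial i f

/-- The coefficient of `∂ⁱ`. -/
def coeff (L : DiffOp δ) (i : ℕ) : K := Polynomial.coeff L i

@[ext] theorem ext {L M : DiffOp δ} (h : ∀ i, L.coeff i = M.coeff i) : L = M :=
  Polynomial.ext h

@[simp] theorem coeff_add (L M : DiffOp δ) (i : ℕ) : (L + M).coeff i = L.coeff i + M.coeff i :=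
  Polynomial.coeff_add L M i

theorem mono_add (i : ℕ) (f g : K) : mono δ i (f + g) = mono δ i f + mono δ i g :=
  (monomial i).map_add f g

@[simp] theorem mono_zero (i : ℕ) : mono δ i 0 = 0 := (monomial i).map_zero

theorem smul_mono (c : K) (i : ℕ) (f : K) : c • mono δ i f = mono δ i (c * f) :=
  Polynomial.smul_monomial c i f

@[elab_as_elim]
theorem induction {P : DiffOp δ → Prop} (L : DiffOp δ)
    (hadd : ∀ L M, P L → P M → P (L + M)) (hmono : ∀ i f, P (mono δ i f)) : P L :=
  Polynomial.induction_on' (motive := P) L hadd hmono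

/-- Left multiplication by `∂`: `∂ · ∑ gⱼ ∂ʲ = ∑ (gⱼ ∂ʲ⁺¹ + δ(gⱼ) ∂ʲ)`. -/
def dmul (δ : Derivation ℤ K K) : AddMonoid.End (DiffOp δ) where
  toFun M := Polynomial.sum M fun j g => mono δ (j + 1) g + mono δ j (δ g)
  map_zero' := Polynomial.sum_zero_index _
  map_add' M N := Polynomial.sum_add_index M N _ (fun i => by simp)
    (fun i f g => by rw [map_add, mono_add, mono_add]; abel)

theorem dmul_mono (j : ℕ) (g : K) :
    dmul δ (mono δ j g) = mono δ (j + 1) g + mono δ j (δ g) :=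
  Polynomial.sum_monomial_index (S := DiffOp δ) g
    (fun j g => mono δ (j + 1) g + mono δ j (δ g)) (by simp)

/-- Left multiplication by the scalar `f`, as an additive map. -/
def smulHom (f : K) : AddMonoid.End (DiffOp δ) := DistribSMul.toAddMonoidHom (DiffOp δ) f

theorem smulHom_add (f g : K) : smulHom (δ := δ) (f + g) = smulHom f + smulHom g :=
  AddMonoidHom.ext fun M => add_smul f g M

theorem smulHom_zero : smulHom (δ := δ) 0 = 0 := AddMonoidHom.ext fun M => zero_smul K M

/-- Left multiplication by `∑ fᵢ ∂ⁱ`: it sends `M` to `∑ fᵢ (∂ (∂ ⋯ (∂ M)))`. -/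
def lmul : DiffOp δ →+ AddMonoid.End (DiffOp δ) where
  toFun L := Polynomial.sum L fun i f => smulHom f * dmul δ ^ i
  map_zero' := Polynomial.sum_zero_index _
  map_add' L M := Polynomial.sum_add_index L M _
    (fun i => by rw [smulHom_zero, zero_mul]) (fun i f g => by rw [smulHom_add, add_mul])

instance : Mul (DiffOp δ) := ⟨fun L M => lmul L M⟩
instance : One (DiffOp δ) := ⟨mono δ 0 1⟩

theorem mono_mul (i : ℕ) (f : K) (M : DiffOp δ) : mono δ i f * M = f • (dmul δ)^[i] M := by
  have h : lmul (mono δ i f) = smulHom f * dmul δ ^ i :=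
    Polynomial.sum_monomial_index f (fun i f => smulHom (δ := δ) f * dmul δ ^ i)
      (by rw [smulHom_zero, zero_mul])
  change lmul (mono δ i f) M = _
  rw [h, ← AddMonoid.End.coe_pow]
  rfl

protected theorem add_mul' (L M N : DiffOp δ) : (L + M) * N = L * N + M * N := by
  change lmul (L + M) N = lmul L N + lmul M N
  rw [map_add]; rfl

protected theorem mul_add' (L M N : DiffOp δ) : L * (M + N) = L * M + L * N :=
  map_add (lmul L) M N

theorem smul_mul' (c : K) (L M : DiffOp δ) : (c • L) * M = c • (L * M) := by
  induction L using DiffOp.induction with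
  | hadd L N hL hN => rw [smul_add, DiffOp.add_mul', DiffOp.add_mul', hL, hN, smul_add]
  | hmono i f => rw [smul_mono, mono_mul, mono_mul, mul_smul]

theorem dmul_smul (c : K) (M : DiffOp δ) : dmul δ (c • M) = c • dmul δ M + δ c • M := by
  induction M using DiffOp.induction with
  | hadd L N hL hN => rw [smul_add, map_add, hL, hN, map_add, smul_add, smul_add]; abel
  | hmono i f =>
    rw [smul_mono, dmul_mono, dmul_mono, smul_add, smul_mono, smul_mono, smul_mono,
      Derivation.leibniz, mono_add, smul_eq_mul, smul_eq_mul, mul_comm f, add_assoc]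

theorem dmul_mul (L M : DiffOp δ) : dmul δ L * M = dmul δ (L * M) := by
  induction L using DiffOp.induction with
  | hadd L N hL hN => rw [map_add, DiffOp.add_mul', DiffOp.add_mul', hL, hN, map_add]
  | hmono i f =>
    rw [dmul_mono, DiffOp.add_mul', mono_mul, mono_mul, mono_mul, dmul_smul,
      Function.iterate_succ_apply']

theorem iterate_dmul_mul (i : ℕ) (L M : DiffOp δ) :
    (dmul δ)^[i] L * M = (dmul δ)^[i] (L * M) := by
  induction i with
  | zero => rfl
  | succ i ih => rw [Function.iterate_succ_apply', Function.iterate_succ_apply', dmul_mul, ih]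

theorem iterate_dmul_one (i : ℕ) : (dmul δ)^[i] (1 : DiffOp δ) = mono δ i 1 := by
  induction i with
  | zero => rfl
  | succ i ih =>
    rw [Function.iterate_succ_apply', ih, dmul_mono, Derivation.map_one_eq_zero]
    rw [mono_zero, add_zero]

instance : Ring (DiffOp δ) where
  __ := (inferInstance : AddCommGroup (DiffOp δ))
  zsmul := fun n L => n • L
  nsmul := fun n L => n • L
  left_distrib := DiffOp.mul_add'
  right_distrib := DiffOp.add_mul'
  zero_mul M := by
    change lmul 0 M = 0
    rw [map_zero]; rfl
  mul_zero L := map_zero (lmul L)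
  one_mul M := by
    change mono δ 0 1 * M = M
    rw [mono_mul, one_smul]; rfl
  mul_one L := by
    induction L using DiffOp.induction with
    | hadd L N hL hN => rw [DiffOp.add_mul', hL, hN]
    | hmono i f => rw [mono_mul, iterate_dmul_one, smul_mono, mul_one]
  mul_assoc L M N := by
    induction L using DiffOp.induction with
    | hadd L L' hL hL' => simp only [DiffOp.add_mul', hL, hL']
    | hmono i f => rw [mono_mul, mono_mul, smul_mul', iterate_dmul_mul]

instance : IsScalarTower K (DiffOp δ) (DiffOp δ) := ⟨smul_mul'⟩

/-- The element `∂` of `K⟨∂⟩`. -/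
def d : DiffOp δ := mono δ 1 1

/-- The inclusion of the field `K` in `K⟨∂⟩`, as operators of order zero. -/
def ofField (δ : Derivation ℤ K K) : K →+* DiffOp δ where
  toFun f := mono δ 0 f
  map_one' := rfl
  map_mul' f g := by rw [mono_mul]; exact (smul_mono f 0 g).symm
  map_zero' := (monomial 0).map_zero
  map_add' := mono_add 0

theorem ofField_mul (f : K) (M : DiffOp δ) : ofField δ f * M = f • M := mono_mul 0 f M

/-- The Leibniz rule `∂ f = f ∂ + δ(f)`. -/
theorem d_mul_ofField (f : K) : d * ofField δ f = ofField δ f * d + ofField δ (δ f) := by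
  rw [ofField_mul, d, smul_mono, mul_one, mono_mul, one_smul]
  exact dmul_mono 0 f

theorem d_pow (i : ℕ) : (d : DiffOp δ) ^ i = mono δ i 1 := by
  induction i with
  | zero => rfl
  | succ i ih =>
    rw [pow_succ', ih, d, mono_mul, one_smul]
    change dmul δ _ = _
    rw [← iterate_dmul_one, ← iterate_dmul_one, Function.iterate_succ_apply']

theorem mono_eq (i : ℕ) (f : K) : mono δ i f = ofField δ f * d ^ i := by
  rw [d_pow, ofField_mul, smul_mono, mul_one]

/-! ### Decomposability of operators -/

/-- The left ideal `K⟨∂⟩ L`. -/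
def leftIdeal (L : DiffOp δ) : Submodule (DiffOp δ) (DiffOp δ) := Submodule.span (DiffOp δ) {L}

/-- `L = LCLM(L₁, L₂)`. -/
def IsLCLM (L L₁ L₂ : DiffOp δ) : Prop := leftIdeal L = leftIdeal L₁ ⊓ leftIdeal L₂

/-- `L = GCRD(L₁, L₂)`. -/
def IsGCRD (L L₁ L₂ : DiffOp δ) : Prop := leftIdeal L = leftIdeal L₁ ⊔ leftIdeal L₂

/-- `L` is decomposable: it is the `LCLM` of two coprime operators, neither of which is in `K`. -/
def Decomposable (L : DiffOp δ) : Prop :=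
  ∃ L₁ L₂ : DiffOp δ, L₁ ∉ Set.range (ofField δ) ∧ L₂ ∉ Set.range (ofField δ) ∧
    IsGCRD 1 L₁ L₂ ∧ IsLCLM L L₁ L₂

/-- `L` is indecomposable. -/
def Indecomposable (L : DiffOp δ) : Prop := ¬ Decomposable L

/-- The left `K⟨∂⟩`-module `𝒟_L = K⟨∂⟩ / K⟨∂⟩ L`; it is in particular a `K`-vector space. -/
abbrev QuotMod (L : DiffOp δ) : Type _ := DiffOp δ ⧸ leftIdeal L

/-! ### The `p`-curvature -/

section pcurv

variable (p : ℕ) [Fact p.Prime] [CharP K p]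

theorem d_pow_p_mul_ofField (f : K) :
    d ^ p * ofField δ f = ofField δ f * d ^ p + ofField δ (δ^[p] f) := by
  let l : Module.End ℤ (DiffOp δ) := LinearMap.mulLeft ℤ d
  let r : Module.End ℤ (DiffOp δ) := LinearMap.mulRight ℤ d
  have hlr : Commute l r := LinearMap.commute_mulLeft_right _ _
  have hc : Commute (l - r) r := hlr.sub_left (Commute.refl r)
  obtain ⟨s, hs⟩ := hc.exists_add_pow_prime_eq (Fact.out : p.Prime)
  have hp : ∀ M : DiffOp δ, p • M = 0 := fun M => by
    rw [← Nat.cast_smul_eq_nsmul K, CharP.cast_eq_zero, zero_smul]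
  have hk : ∀ k, ((l - r) ^ k) (ofField δ f) = ofField δ (δ^[k] f) := by
    intro k
    induction k with
    | zero => rfl
    | succ k ih =>
      rw [pow_succ', Module.End.mul_apply, ih, Function.iterate_succ_apply']
      change d * _ - _ * d = _
      rw [d_mul_ofField, add_sub_cancel_left]
  have h := congrArg (fun E : Module.End ℤ (DiffOp δ) => E (ofField δ f)) hs
  simp only [sub_add_cancel, LinearMap.add_apply, hk] at h
  rw [mul_assoc, mul_assoc, Module.End.mul_apply, Module.End.natCast_apply, hp, add_zero,
    LinearMap.pow_mulLeft, LinearMap.pow_mulRight] at h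
  simpa [add_comm] using h

variable {p}

/-- Multiplication by `∂ᵖ` on `𝒟_L`, as a `K`-linear map, when `δᵖ = 0`. -/
def mulDPow (hδ : ∀ f, δ^[p] f = 0) (L : DiffOp δ) : QuotMod L →ₗ[K] QuotMod L where
  toFun m := (d ^ p : DiffOp δ) • m
  map_add' := smul_add _
  map_smul' c m := by
    have h : ∀ m : QuotMod L, c • m = ofField δ c • m := fun m => by
      rw [← one_smul (DiffOp δ) m, ← smul_assoc, ← smul_assoc, ← ofField_mul, smul_eq_mul]
    rw [RingHom.id_apply, h, h, ← mul_smul, ← mul_smul, d_pow_p_mul_ofField, hδ, map_zero,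
      add_zero]

theorem iterate_p_mul (f g : K) : δ^[p] (f * g) = f * δ^[p] g + g * δ^[p] f := by
  have h := d_pow_p_mul_ofField (δ := δ) p (f * g)
  have hinj : Function.Injective (ofField δ) := Polynomial.monomial_injective 0
  apply hinj
  rw [map_mul, ← mul_assoc, d_pow_p_mul_ofField, add_mul, mul_assoc, d_pow_p_mul_ofField,
    mul_add, ← mul_assoc, add_assoc] at h
  rw [← add_left_cancel h]
  simp only [← map_mul, ← map_add, mul_comm]

end pcurv

end DiffOp

section

variable (p : ℕ) [Fact p.Prime] {F K : Type*} [Field F] [CharP F p] [Field K]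
  [Algebra (RatFunc F) K] [Algebra.IsSeparable (RatFunc F) K]

/-- The `p`-th iterate of `d/dt` vanishes in characteristic `p`. -/
theorem ddt_iterate_p (f : K) : (ddt F K)^[p] f = 0 := by
  have : CharP K p := charP_of_injective_ringHom
    (((algebraMap (RatFunc F) K).comp RatFunc.C).injective) p
  have hp : p.Prime := Fact.out
  have hpow : ∀ x, ((ddt F K : Module.End ℤ K) ^ p) x = (ddt F K)^[p] x := fun x =>
    Module.End.pow_apply _ _ _
  let E : Derivation ℤ K K := Derivation.mk' ((ddt F K : Module.End ℤ K) ^ p) (fun a b => by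
    rw [hpow, hpow, hpow]
    exact DiffOp.iterate_p_mul a b)
  rw [← hpow]
  change E f = 0
  obtain ⟨m, rfl⟩ : ∃ m, p = m + 2 := ⟨p - 2, by have := hp.two_le; omega⟩
  have h0 : ∀ k, (ddt F K)^[k] 0 = 0 := fun k => by
    induction k with
    | zero => rfl
    | succ k ih => rw [Function.iterate_succ_apply, map_zero, ih]
  refine derivation_eq_zero_of_sep (F := F) E (fun a => ?_) ?_ f
  · change ((ddt F K : Module.End ℤ K) ^ (m + 2)) _ = 0
    rw [hpow, Function.iterate_succ_apply, ddt_C, h0]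
  · change ((ddt F K : Module.End ℤ K) ^ (m + 2)) _ = 0
    rw [hpow, Function.iterate_succ_apply, ddt_X, Function.iterate_succ_apply,
      Derivation.map_one_eq_zero, h0]

/-- The `p`-curvature of an operator `L ∈ K⟨∂⟩`: the `K`-linear endomorphism of `𝒟_L` given by
multiplication by `∂ᵖ`. -/
def pCurvature (L : DiffOp (ddt F K)) : Module.End K L.QuotMod :=
  haveI : CharP K p := charP_of_injective_ringHom
    (((algebraMap (RatFunc F) K).comp RatFunc.C).injective) p
  DiffOp.mulDPow (ddt_iterate_p p) L

theorem pCurvature_apply (L : DiffOp (ddt F K)) (m : L.QuotMod) :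
    pCurvature p L m = (DiffOp.d ^ p : DiffOp (ddt F K)) • m := rfl

end

/-- The nilpotent Jordan block of size `n` (ones just above the diagonal, zeros elsewhere). -/
def nilpotentJordanBlock (K : Type*) [Field K] (n : ℕ) : Matrix (Fin n) (Fin n) K :=
  Matrix.of fun i j => if (i : ℕ) + 1 = j then 1 else 0

/-- The variable `t`, as an element of an extension `K` of `F(t)`. -/
def tVar (F K : Type*) [Field F] [Field K] [Algebra (RatFunc F) K] : K :=
  algebraMap (RatFunc F) K RatFunc.X

/-- The operator `t∂` (the Euler operator). -/
def eulerOp (F K : Type*) [Field F] [Field K] [Algebra (RatFunc F) K]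
    [Algebra.IsSeparable (RatFunc F) K] : DiffOp (ddt F K) :=
  DiffOp.ofField (ddt F K) (tVar F K) * DiffOp.d

end

/-! Write θ = t∂ and L = θⁿ. The identity tᵖ∂ᵖ = θ(θ-1)⋯(θ-p+1), together with the fact that ∂ᵖ
commutes with K (since δᵖ = 0), gives tᵖᵐ∂ᵖᵐ = (c + rθ)θᵐ, where c is ((p-1)!)ᵐ up to sign and so is
nonzero in K (`exists_d_pow_eq`). Hence ∂ᵖᵐ lies in the left ideal of θᵐ but not in that of θᵐ⁺¹.
For the p-curvature ψ this says that ψⁿ kills the class of 1 while ψⁿ⁻¹ does not.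

The classes of θⁱ with i < n span 𝒟_L, so its dimension is n and the class of 1 is a cyclic vector
for ψ. This yields the Jordan block.

For indecomposability, a vector not killed by ψⁿ⁻¹ is cyclic, so every proper submodule lies in ker
ψⁿ⁻¹ (`pCurvature_pow_mk_eq_zero`). Two proper left ideals containing L therefore cannot sum to the
whole ring, as the class of 1 is outside that kernel. -/

/-- If `ψⁿ v = 0` and `ψⁿ⁻¹ v ≠ 0`, the vectors `v, ψ v, …, ψⁿ⁻¹ v` are linearly independent. -/
theorem linearIndependent_pow_apply {K V : Type*} [Field K] [AddCommGroup V] [Module K V]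
    (ψ : Module.End K V) (v : V) (n : ℕ) (h0 : (ψ ^ n) v = 0)
    -- Writing m + 1 = n makes this vacuous for n = 0, where truncated n - 1 would contradict `h0`.
    (h1 : ∀ m, m + 1 = n → (ψ ^ m) v ≠ 0) :
    LinearIndependent K fun i : Fin n => (ψ ^ (i : ℕ)) v := by
  induction n generalizing v with
  | zero => exact linearIndependent_empty_type
  | succ n ih =>
    have hn : (ψ ^ n) v ≠ 0 := h1 n rfl
    rw [linearIndependent_finSucc]
    have hs : (Fin.tail fun i : Fin (n + 1) => (ψ ^ (i : ℕ)) v) =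
        fun i : Fin n => (ψ ^ (i : ℕ)) (ψ v) := by
      funext i
      simp [Fin.tail, pow_succ]
    rw [hs]
    refine ⟨ih (ψ v) ?_ ?_, fun hmem => hn ?_⟩
    · rwa [pow_succ] at h0
    · rintro m rfl
      rwa [pow_succ] at hn
    -- The vectors after the first all lie in ker ψⁿ, and v does not.
    · have hle : Submodule.span K (Set.range fun i : Fin n => (ψ ^ (i : ℕ)) (ψ v)) ≤
          LinearMap.ker (ψ ^ n) := by
        rw [Submodule.span_le]
        rintro _ ⟨i, rfl⟩
        rw [SetLike.mem_coe, LinearMap.mem_ker, ← Module.End.mul_apply, ← pow_add, add_comm,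
          pow_add, Module.End.mul_apply, ← Module.End.mul_apply (ψ ^ n), ← pow_succ, h0, map_zero]
      simpa using hle hmem

/-! ### Orders of operators and proper left ideals -/

namespace DiffOp

variable {K : Type*} [Field K] {δ : Derivation ℤ K K}

theorem coeff_mono (i j : ℕ) (f : K) : (mono δ i f).coeff j = if i = j then f else 0 :=
  Polynomial.coeff_monomial

/-- The coefficient of `∂ⁱ`, as an additive map. -/
def coeffHom (δ : Derivation ℤ K K) (i : ℕ) : DiffOp δ →+ K where
  toFun L := L.coeff i
  map_zero' := Polynomial.coeff_zero i
  map_add' L M := coeff_add L M i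

theorem coeff_smul (c : K) (L : DiffOp δ) (i : ℕ) : (c • L).coeff i = c * L.coeff i :=
  Polynomial.coeff_smul c L i

theorem coeff_dmul_succ (M : DiffOp δ) (j : ℕ) :
    (dmul δ M).coeff (j + 1) = M.coeff j + δ (M.coeff (j + 1)) := by
  induction M using DiffOp.induction with
  | hadd L M hL hM => rw [map_add, coeff_add, hL, hM, coeff_add, coeff_add, map_add]; abel
  | hmono i f =>
    rw [dmul_mono, coeff_add, coeff_mono, coeff_mono, coeff_mono, coeff_mono]
    congr 1
    · simp
    · split_ifs <;> simp

/-- Each multiplication by ∂ raises the order by one and keeps the leading coefficient; the δ-terms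
only affect lower coefficients. -/
theorem coeff_iterate_dmul (M : DiffOp δ) (k : ℕ) (hM : ∀ j, k < j → M.coeff j = 0) (i : ℕ) :
    ((dmul δ)^[i] M).coeff (i + k) = M.coeff k ∧
      ∀ j, i + k < j → ((dmul δ)^[i] M).coeff j = 0 := by
  induction i with
  | zero => exact ⟨by rw [zero_add]; rfl, fun j hj => hM j (by omega)⟩
  | succ i ih =>
    rw [Function.iterate_succ_apply']
    refine ⟨?_, fun j hj => ?_⟩
    · rw [show i + 1 + k = i + k + 1 by omega, coeff_dmul_succ, ih.1, ih.2 _ (by omega), map_zero,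
        add_zero]
    · obtain ⟨j, rfl⟩ : ∃ j', j = j' + 1 := ⟨j - 1, by omega⟩
      rw [coeff_dmul_succ, ih.2 _ (by omega), ih.2 _ (by omega), map_zero, add_zero]

theorem eq_sum_mono (L : DiffOp δ) :
    L = ∑ i ∈ Finset.range (Polynomial.natDegree L + 1), mono δ i (L.coeff i) :=
  Polynomial.as_sum_range L

theorem coeff_sum {ι : Type*} (s : Finset ι) (f : ι → DiffOp δ) (j : ℕ) :
    (∑ i ∈ s, f i).coeff j = ∑ i ∈ s, (f i).coeff j :=
  map_sum (coeffHom δ j) f s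

/-- Only the leading term of L reaches this degree, so orders add and leading coefficients multiply
as for commuting polynomials. -/
theorem coeff_mul_natDegree (L M : DiffOp δ) :
    (L * M).coeff (Polynomial.natDegree L + Polynomial.natDegree M) =
      Polynomial.leadingCoeff L * Polynomial.leadingCoeff M := by
  have hM : ∀ j, Polynomial.natDegree M < j → M.coeff j = 0 := fun j hj =>
    Polynomial.coeff_eq_zero_of_natDegree_lt hj
  have h : L * M =
      ∑ i ∈ Finset.range (Polynomial.natDegree L + 1), mono δ i (L.coeff i) * M := by
    conv_lhs => rw [eq_sum_mono L]
    exact Finset.sum_mul _ _ _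
  rw [h, coeff_sum, Finset.sum_range_succ, Finset.sum_eq_zero, zero_add]
  · rw [mono_mul, coeff_smul, (coeff_iterate_dmul M _ hM _).1]
    rfl
  · intro i hi
    rw [mono_mul, coeff_smul, (coeff_iterate_dmul M _ hM _).2, mul_zero]
    have := Finset.mem_range.1 hi
    omega

theorem mem_leftIdeal {L M : DiffOp δ} : M ∈ leftIdeal L ↔ ∃ a, a * L = M :=
  Submodule.mem_span_singleton

/-- If aL = 1, the orders of a and L add up to 0, which puts L in K. -/
theorem leftIdeal_ne_top {L : DiffOp δ} (hL : L ∉ Set.range (ofField δ)) : leftIdeal L ≠ ⊤ := by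
  intro h
  obtain ⟨a, ha⟩ := mem_leftIdeal.1 (h ▸ Submodule.mem_top : (1 : DiffOp δ) ∈ leftIdeal L)
  have hL0 : L ≠ 0 := fun h => hL ⟨0, by rw [h, map_zero]⟩
  have h10 : (1 : DiffOp δ) ≠ 0 := fun h => hL0 (by rw [← one_mul L, h, zero_mul])
  have ha0 : a ≠ 0 := fun h => h10 (by rw [← ha, h, zero_mul])
  have hc := coeff_mul_natDegree a L
  rw [ha] at hc
  have hne : Polynomial.leadingCoeff a * Polynomial.leadingCoeff L ≠ 0 :=
    mul_ne_zero (Polynomial.leadingCoeff_ne_zero.2 ha0) (Polynomial.leadingCoeff_ne_zero.2 hL0)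
  rw [← hc] at hne
  have h1 : ∀ j, (1 : DiffOp δ).coeff j = if 0 = j then 1 else 0 := fun j => coeff_mono 0 j 1
  rw [h1] at hne
  have hd : Polynomial.natDegree L = 0 := by
    by_contra hd
    exact hne (if_neg (by omega))
  exact hL ⟨L.coeff 0, (Polynomial.eq_C_of_natDegree_eq_zero hd).symm⟩

/-! ### Right multiplication by ∂ and by θ = t∂ -/

theorem mono_mul_d (i : ℕ) (f : K) : mono δ i f * d = mono δ (i + 1) f := by
  rw [mono_eq, mul_assoc, ← pow_succ, ← mono_eq]

theorem coeff_mul_d_succ (L : DiffOp δ) (j : ℕ) : (L * d).coeff (j + 1) = L.coeff j := by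
  induction L using DiffOp.induction with
  | hadd L M hL hM => rw [add_mul, coeff_add, hL, hM, coeff_add]
  | hmono i f => rw [mono_mul_d, coeff_mono, coeff_mono]; simp

theorem coeff_mul_d_zero (L : DiffOp δ) : (L * d).coeff 0 = 0 := by
  induction L using DiffOp.induction with
  | hadd L M hL hM => rw [add_mul, coeff_add, hL, hM, add_zero]
  | hmono i f => rw [mono_mul_d, coeff_mono]; simp

theorem mul_d_injective : Function.Injective fun L : DiffOp δ => L * d := fun L M h =>
  ext fun i => by rw [← coeff_mul_d_succ L, ← coeff_mul_d_succ M]; exact congrArg (coeff · _) h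

theorem mul_euler_injective {t : K} (ht : t ≠ 0) :
    Function.Injective fun L : DiffOp δ => L * (ofField δ t * d) := by
  intro L M h
  have h' : L * ofField δ t = M * ofField δ t := mul_d_injective (by simpa [mul_assoc] using h)
  have h2 := congrArg (· * ofField δ t⁻¹) h'
  simpa [mul_assoc, ← map_mul, ht] using h2

theorem mul_euler_pow_injective {t : K} (ht : t ≠ 0) (m : ℕ) :
    Function.Injective fun L : DiffOp δ => L * (ofField δ t * d) ^ m := by
  induction m with
  | zero => intro L M h; simpa using h
  | succ m ih =>
    intro L M h
    refine ih (mul_euler_injective ht ?_)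
    simpa [pow_succ, mul_assoc] using h

theorem mul_euler_ne_one (t : K) (a : DiffOp δ) : a * (ofField δ t * d) ≠ 1 := by
  intro h
  have h1 := coeff_mul_d_zero (a * ofField δ t)
  rw [mul_assoc, h] at h1
  have h2 : (1 : DiffOp δ).coeff 0 = 1 := (coeff_mono 0 0 1).trans (if_pos rfl)
  exact one_ne_zero (h2.symm.trans h1)

/-- Cancelling θᵐ on the right of aθᵐ⁺¹ = θᵐ would make θ left invertible, but a right multiple of ∂
has no constant coefficient. -/
theorem euler_pow_notMem {t : K} (ht : t ≠ 0) (m : ℕ) :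
    (ofField δ t * d) ^ m ∉ leftIdeal ((ofField δ t * d) ^ (m + 1)) := by
  intro h
  obtain ⟨a, ha⟩ := mem_leftIdeal.1 h
  refine mul_euler_ne_one t a (mul_euler_pow_injective ht m ?_)
  simpa [pow_succ', mul_assoc] using ha

/-! ### Powers of t and ∂ in terms of θ -/

theorem d_pow_mul_ofField {t : K} (ht : δ t = 1) (k : ℕ) :
    (d : DiffOp δ) ^ (k + 1) * ofField δ t =
      ofField δ t * d ^ (k + 1) + ((k + 1 : ℕ) : DiffOp δ) * d ^ k := by
  induction k with
  | zero => simp [d_mul_ofField, ht]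
  | succ k ih =>
    rw [pow_succ', mul_assoc, ih, mul_add, ← mul_assoc, d_mul_ofField, ht, map_one,
      ← mul_assoc d, (Nat.cast_commute (k + 1) (d : DiffOp δ)).symm.eq, mul_assoc _ d, ← pow_succ']
    push_cast
    rw [add_mul _ _ (d ^ (k + 1)), mul_assoc _ d, ← pow_succ']
    noncomm_ring

/-- `tᵏ⁺¹ ∂ᵏ⁺¹ = θ (θ - 1) ⋯ (θ - k)` for `θ = t ∂`. -/
theorem ofField_pow_mul_d_pow {t : K} (ht : δ t = 1) (k : ℕ) :
    ofField δ t ^ (k + 1) * d ^ (k + 1) =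
      aeval (R := ℤ) (ofField δ t * d)
        (X * ∏ i ∈ Finset.range k, (X - Polynomial.C ((i : ℤ) + 1))) := by
  induction k with
  | zero => simp
  | succ k ih =>
    rw [Finset.prod_range_succ, ← mul_assoc, map_mul, ← ih, map_sub, aeval_X, aeval_C, mul_sub]
    -- Moving the inner t to the left of ∂ᵏ⁺¹ creates a term with factor k + 1, which cancels the
    -- subtracted constant.
    have h1 : ofField δ t ^ (k + 1) * d ^ (k + 1) * (ofField δ t * d) =
        ofField δ t ^ (k + 1) * (d ^ (k + 1) * ofField δ t) * d := by noncomm_ring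
    have h2 : (algebraMap ℤ (DiffOp δ)) ((k : ℤ) + 1) = ((k + 1 : ℕ) : DiffOp δ) := by simp
    rw [h1, d_pow_mul_ofField ht, h2, ← (Nat.cast_commute (k + 1) _).eq, mul_add, add_mul,
      pow_succ (ofField δ t) (k + 1), pow_succ d (k + 1)]
    have h3 : ofField δ t ^ (k + 1) * (((k + 1 : ℕ) : DiffOp δ) * d ^ k) * d =
        ((k + 1 : ℕ) : DiffOp δ) * (ofField δ t ^ (k + 1) * d ^ (k + 1)) := by
      rw [← mul_assoc, ← (Nat.cast_commute (k + 1) (ofField δ t ^ (k + 1))).eq, pow_succ d k]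
      noncomm_ring
    rw [h3]
    noncomm_ring

/-- The powers of `t∂` span `K⟨∂⟩` over `K`. -/
theorem span_euler_pow {t : K} (ht : t ≠ 0) :
    Submodule.span K (Set.range fun i : ℕ => (ofField δ t * d) ^ i) = ⊤ := by
  set S := Submodule.span K (Set.range fun i : ℕ => (ofField δ t * d) ^ i)
  -- Stability under ∂ follows from ∂θⁱ = t⁻¹θⁱ⁺¹ and the Leibniz rule.
  have hd : ∀ M ∈ S, d * M ∈ S := by
    intro M hM
    induction hM using Submodule.span_induction with
    | mem x hx =>
      obtain ⟨i, rfl⟩ := hx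
      have h : d * (ofField δ t * d) ^ i = t⁻¹ • (ofField δ t * d) ^ (i + 1) := by
        rw [pow_succ', ← ofField_mul, mul_assoc (ofField δ t), ← mul_assoc, ← map_mul,
          inv_mul_cancel₀ ht, map_one, one_mul]
      rw [h]
      exact S.smul_mem _ (Submodule.subset_span ⟨i + 1, rfl⟩)
    | zero => rw [mul_zero]; exact S.zero_mem
    | add x y _ _ hx hy => rw [mul_add]; exact S.add_mem hx hy
    | smul c x hxS hx =>
      rw [← ofField_mul, ← mul_assoc, d_mul_ofField, add_mul, mul_assoc, ofField_mul, ofField_mul]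
      exact S.add_mem (S.smul_mem _ hx) (S.smul_mem _ hxS)
  have hpow : ∀ i, (d : DiffOp δ) ^ i ∈ S := by
    intro i
    induction i with
    | zero => exact Submodule.subset_span ⟨0, by simp⟩
    | succ i ih => rw [pow_succ']; exact hd _ ih
  refine eq_top_iff.2 fun L _ => ?_
  induction L using DiffOp.induction with
  | hadd L M hL hM => exact S.add_mem (hL trivial) (hM trivial)
  | hmono i f => rw [mono_eq, ofField_mul]; exact S.smul_mem _ (hpow i)

theorem span_mk_euler_pow {t : K} (ht : t ≠ 0) (n : ℕ) :
    Submodule.span K (Set.range fun i : Fin n =>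
      (Submodule.Quotient.mk ((ofField δ t * d) ^ (i : ℕ)) :
        QuotMod ((ofField δ t * d) ^ n))) = ⊤ := by
  set L : DiffOp δ := (ofField δ t * d) ^ n
  let π : DiffOp δ →ₗ[K] QuotMod L := (leftIdeal L).mkQ.restrictScalars K
  have hπ : Function.Surjective π := (leftIdeal L).mkQ_surjective
  rw [eq_top_iff, ← LinearMap.range_eq_top.2 hπ, ← Submodule.map_top, ← span_euler_pow ht,
    Submodule.map_span, Submodule.span_le]
  rintro _ ⟨_, ⟨i, rfl⟩, rfl⟩
  by_cases hi : i < n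
  · exact Submodule.subset_span ⟨⟨i, hi⟩, rfl⟩
  · have : π ((ofField δ t * d) ^ i) = 0 := by
      refine (Submodule.Quotient.mk_eq_zero _).2 (mem_leftIdeal.2 ⟨(ofField δ t * d) ^ (i - n), ?_⟩)
      rw [← pow_add, Nat.sub_add_cancel (not_lt.1 hi)]
    change π ((ofField δ t * d) ^ i) ∈ _
    rw [this]
    exact Submodule.zero_mem _

/-! ### Powers of ∂ᵖ modulo powers of θ -/

section

variable (p : ℕ) [Fact p.Prime] [CharP K p]

/-- In characteristic `p`, `tᵖᵐ ∂ᵖᵐ = (t∂)ᵐ (c + r t∂)` with `c` a nonzero constant. -/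
theorem exists_d_pow_eq {t : K} (ht : δ t = 1) (hδ : ∀ f, δ^[p] f = 0) (m : ℕ) :
    ∃ (c : ℤ) (r : DiffOp δ), (c : K) ≠ 0 ∧
      ofField δ t ^ (p * m) * (d ^ p) ^ m =
        (c : DiffOp δ) * (ofField δ t * d) ^ m + r * (ofField δ t * d) ^ (m + 1) := by
  have hp : p.Prime := Fact.out
  obtain ⟨k, rfl⟩ : ∃ k, p = k + 1 := ⟨p - 1, by have := hp.pos; omega⟩
  -- Integer coefficients are central in K⟨∂⟩, unlike those in K, so evaluation at θ is a ring
  -- homomorphism.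
  let Q : ℤ[X] := ∏ i ∈ Finset.range k, (X - Polynomial.C ((i : ℤ) + 1))
  -- Splitting off the constant term of Qᵐ gives c and r; Q(0) is ±(p-1)!, a unit modulo p.
  refine ⟨(Q ^ m).coeff 0, aeval (ofField δ t * d) (Q ^ m).divX, ?_, ?_⟩
  · rw [coeff_zero_eq_eval_zero, eval_pow, eval_prod, Int.cast_pow, Int.cast_prod]
    refine pow_ne_zero _ (Finset.prod_ne_zero_iff.2 fun i hi => ?_)
    have hne : ((i + 1 : ℕ) : K) ≠ 0 := by
      rw [Ne, CharP.cast_eq_zero_iff K (k + 1)]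
      intro h
      have := Nat.le_of_dvd (Nat.succ_pos i) h
      have := Finset.mem_range.1 hi
      omega
    intro h
    apply hne
    simp at h
    push_cast
    linear_combination -h
  · have hcomm : Commute (ofField δ t ^ (k + 1)) (d ^ (k + 1)) := by
      refine Commute.pow_left ?_ _
      change _ * _ = _ * _
      rw [d_pow_p_mul_ofField, hδ, map_zero, add_zero]
    rw [pow_mul, ← hcomm.mul_pow, ofField_pow_mul_d_pow ht, ← map_pow]
    change aeval _ ((X * Q) ^ m) = _
    have hQ : (X * Q) ^ m =
        Polynomial.C ((Q ^ m).coeff 0) * X ^ m + (Q ^ m).divX * X ^ (m + 1) := by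
      conv_lhs => rw [mul_pow, ← divX_mul_X_add (Q ^ m)]
      ring
    rw [hQ]
    simp

theorem d_pow_mem_leftIdeal {t : K} (ht : δ t = 1) (hδ : ∀ f, δ^[p] f = 0) (m : ℕ) :
    ((d : DiffOp δ) ^ p) ^ m ∈ leftIdeal ((ofField δ t * d) ^ m) := by
  have ht0 : t ≠ 0 := by rintro rfl; simp at ht
  obtain ⟨c, r, -, h⟩ := exists_d_pow_eq p ht hδ m
  refine mem_leftIdeal.2 ⟨ofField δ (t ^ (p * m))⁻¹ * ((c : DiffOp δ) + r * (ofField δ t * d)), ?_⟩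
  rw [mul_assoc, add_mul, mul_assoc r, ← pow_succ', ← h, ← map_pow, ← mul_assoc, ← map_mul,
    inv_mul_cancel₀ (pow_ne_zero _ ht0), map_one, one_mul]

/-- Otherwise cθᵐ, and hence θᵐ because c is invertible in K, would be a left multiple of θᵐ⁺¹. -/
theorem d_pow_notMem_leftIdeal {t : K} (ht : δ t = 1) (hδ : ∀ f, δ^[p] f = 0) (m : ℕ) :
    ((d : DiffOp δ) ^ p) ^ m ∉ leftIdeal ((ofField δ t * d) ^ (m + 1)) := by
  have ht0 : t ≠ 0 := by rintro rfl; simp at ht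
  obtain ⟨c, r, hc, h⟩ := exists_d_pow_eq p ht hδ m
  intro hmem
  apply euler_pow_notMem (δ := δ) ht0 m
  have h1 := (leftIdeal _).smul_mem (ofField δ t ^ (p * m)) hmem
  rw [smul_eq_mul, h] at h1
  have h2 := (leftIdeal _).smul_mem (ofField δ (c : K)⁻¹)
    (((leftIdeal _).add_mem_iff_left (mem_leftIdeal.2 ⟨r, rfl⟩)).1 h1)
  rwa [smul_eq_mul, ← map_intCast (ofField δ) c, ← mul_assoc, ← map_mul, inv_mul_cancel₀ hc,
    map_one, one_mul] at h2

end

end DiffOp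

/-! ### The p-curvature of θⁿ and its cyclic vectors -/

section euler

open DiffOp

variable (p : ℕ) [Fact p.Prime] (F K : Type*) [Field F] [CharP F p] [Field K]
  [Algebra (RatFunc F) K] [Algebra.IsSeparable (RatFunc F) K] (n : ℕ)

theorem pCurvature_pow_apply (L : DiffOp (ddt F K)) (k : ℕ) (v : L.QuotMod) :
    (pCurvature p L ^ k) v = ((d : DiffOp (ddt F K)) ^ p) ^ k • v := by
  induction k with
  | zero => simp
  | succ k ih => rw [pow_succ', Module.End.mul_apply, ih, pCurvature_apply, ← mul_smul, ← pow_succ']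

theorem tVar_ne_zero : tVar F K ≠ 0 := by
  intro h
  have := ddt_X (F := F) (K := K)
  rw [show algebraMap (RatFunc F) K RatFunc.X = 0 from h, map_zero] at this
  exact zero_ne_one this

theorem pCurvature_pow_mk_one (k : ℕ) :
    (pCurvature p (eulerOp F K ^ n) ^ k) (Submodule.Quotient.mk 1) =
      Submodule.Quotient.mk (((d : DiffOp (ddt F K)) ^ p) ^ k) := by
  rw [pCurvature_pow_apply, ← Submodule.Quotient.mk_smul, smul_eq_mul, mul_one]

theorem pCurvature_pow_mk_one_eq_zero :
    (pCurvature p (eulerOp F K ^ n) ^ n) (Submodule.Quotient.mk 1) = 0 := by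
  have : CharP K p := charP_of_injective_ringHom
    (((algebraMap (RatFunc F) K).comp RatFunc.C).injective) p
  rw [pCurvature_pow_mk_one, Submodule.Quotient.mk_eq_zero]
  exact d_pow_mem_leftIdeal p ddt_X (ddt_iterate_p p) n

theorem pCurvature_pow_mk_one_ne_zero (m : ℕ) (hm : m + 1 = n) :
    (pCurvature p (eulerOp F K ^ n) ^ m) (Submodule.Quotient.mk 1) ≠ 0 := by
  have : CharP K p := charP_of_injective_ringHom
    (((algebraMap (RatFunc F) K).comp RatFunc.C).injective) p
  subst hm
  rw [pCurvature_pow_mk_one, Ne, Submodule.Quotient.mk_eq_zero]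
  exact d_pow_notMem_leftIdeal p ddt_X (ddt_iterate_p p) m

theorem span_mk_eulerOp_pow : Submodule.span K (Set.range fun i : Fin n =>
    (Submodule.Quotient.mk (eulerOp F K ^ (i : ℕ)) : (eulerOp F K ^ n).QuotMod)) = ⊤ :=
  span_mk_euler_pow (tVar_ne_zero F K) n

instance finite_quotMod_eulerOp_pow : Module.Finite K (eulerOp F K ^ n).QuotMod :=
  ⟨Submodule.fg_def.2 ⟨_, Set.finite_range _, span_mk_eulerOp_pow F K n⟩⟩

-- The powers of θ bound the dimension from above, the independent vectors ψⁱ(1) from below.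
include p in
theorem finrank_quotMod_eulerOp_pow : Module.finrank K (eulerOp F K ^ n).QuotMod = n := by
  apply le_antisymm
  · have h := finrank_range_le_card (R := K) fun i : Fin n =>
      (Submodule.Quotient.mk (eulerOp F K ^ (i : ℕ)) : (eulerOp F K ^ n).QuotMod)
    rwa [Set.finrank, span_mk_eulerOp_pow, finrank_top, Fintype.card_fin] at h
  · have h := (linearIndependent_pow_apply _ _ n (pCurvature_pow_mk_one_eq_zero p F K n)
      (pCurvature_pow_mk_one_ne_zero p F K n)).fintype_card_le_finrank
    rwa [Fintype.card_fin] at h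

/-- Any vector outside ker ψⁿ⁻¹ is cyclic: it yields n independent vectors in dimension n. -/
theorem span_pCurvature_pow (v : (eulerOp F K ^ n).QuotMod)
    (h0 : (pCurvature p (eulerOp F K ^ n) ^ n) v = 0)
    (h1 : ∀ m, m + 1 = n → (pCurvature p (eulerOp F K ^ n) ^ m) v ≠ 0) :
    Submodule.span K
      (Set.range fun i : Fin n => (pCurvature p (eulerOp F K ^ n) ^ (i : ℕ)) v) = ⊤ :=
  (linearIndependent_pow_apply _ v n h0 h1).span_eq_top_of_card_eq_finrank' (by
    rw [Fintype.card_fin, finrank_quotMod_eulerOp_pow p])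

theorem pCurvature_pow_eq_zero : pCurvature p (eulerOp F K ^ n) ^ n = 0 := by
  have h0 := pCurvature_pow_mk_one_eq_zero p F K n
  rw [← LinearMap.ker_eq_top, eq_top_iff,
    ← span_pCurvature_pow p F K n _ h0 (pCurvature_pow_mk_one_ne_zero p F K n), Submodule.span_le]
  rintro _ ⟨i, rfl⟩
  rw [SetLike.mem_coe, LinearMap.mem_ker, ← Module.End.mul_apply, ← pow_add, add_comm, pow_add,
    Module.End.mul_apply, h0, map_zero]

/-- Proper left ideals containing `(t∂)ᵐ⁺¹` are killed by the `m`-th power of the `p`-curvature. -/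
theorem pCurvature_pow_mk_eq_zero {m : ℕ} {I : Submodule (DiffOp (ddt F K)) (DiffOp (ddt F K))}
    (hI : leftIdeal (eulerOp F K ^ (m + 1)) ≤ I) (hI' : I ≠ ⊤) {x : DiffOp (ddt F K)}
    (hx : x ∈ I) :
    (pCurvature p (eulerOp F K ^ (m + 1)) ^ m) (Submodule.Quotient.mk x) = 0 := by
  by_contra h
  have hs := span_pCurvature_pow p F K (m + 1) (Submodule.Quotient.mk x)
    (by rw [pCurvature_pow_eq_zero, LinearMap.zero_apply])
    (fun m' hm' => by rwa [Nat.succ_injective hm'])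
  -- The image of I is a K-subspace stable under ∂ᵖ, so it contains the span of the ψⁱ(x), which is
  -- everything.
  let N : Submodule K (eulerOp F K ^ (m + 1)).QuotMod :=
    (I.map (leftIdeal (eulerOp F K ^ (m + 1))).mkQ).restrictScalars K
  have hN : N = ⊤ := by
    rw [eq_top_iff, ← hs, Submodule.span_le]
    rintro _ ⟨i, rfl⟩
    refine ⟨((d : DiffOp (ddt F K)) ^ p) ^ (i : ℕ) * x, I.smul_mem _ hx, ?_⟩
    exact (pCurvature_pow_apply p F K _ _ (Submodule.Quotient.mk x)).symm
  obtain ⟨y, hy, hy1⟩ : (Submodule.Quotient.mk 1 : (eulerOp F K ^ (m + 1)).QuotMod) ∈ N :=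
    hN ▸ Submodule.mem_top
  -- Since I contains the ideal being factored out, membership of the class of 1 in the image lifts
  -- to 1 ∈ I.
  have h1 : (1 : DiffOp (ddt F K)) ∈ I :=
    (I.sub_mem_iff_right hy).1 (hI ((Submodule.Quotient.eq _).1 hy1))
  exact hI' (eq_top_iff.2 fun z _ => by simpa using I.smul_mem z h1)

include p in
theorem indecomposable_eulerOp_pow : (eulerOp F K ^ n).Indecomposable := by
  rintro ⟨L₁, L₂, h₁, h₂, hsup, hinf⟩
  have hle₁ : leftIdeal (eulerOp F K ^ n) ≤ leftIdeal L₁ := hinf.le.trans inf_le_left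
  have hle₂ : leftIdeal (eulerOp F K ^ n) ≤ leftIdeal L₂ := hinf.le.trans inf_le_right
  have h1 : (1 : DiffOp (ddt F K)) ∈ leftIdeal L₁ ⊔ leftIdeal L₂ :=
    hsup.le (mem_leftIdeal.2 ⟨1, one_mul 1⟩)
  cases n with
  | zero =>
    -- Here L = 1, whose left ideal is the whole ring and is contained in that of L₁.
    refine leftIdeal_ne_top h₁ (eq_top_iff.2 fun x _ => hle₁ (mem_leftIdeal.2 ⟨x, ?_⟩))
    rw [pow_zero, mul_one]
  | succ m =>
    obtain ⟨x, hx, y, hy, hxy⟩ := Submodule.mem_sup.1 h1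
    -- With 1 = x + y, both summands are killed by ψᵐ, although 1 is not.
    refine pCurvature_pow_mk_one_ne_zero p F K (m + 1) m rfl ?_
    rw [← hxy, Submodule.Quotient.mk_add, map_add,
      pCurvature_pow_mk_eq_zero p F K hle₁ (leftIdeal_ne_top h₁) hx,
      pCurvature_pow_mk_eq_zero p F K hle₂ (leftIdeal_ne_top h₂) hy, add_zero]

theorem exists_basis_toMatrix_pCurvature :
    ∃ b : Module.Basis (Fin n) K (eulerOp F K ^ n).QuotMod,
      LinearMap.toMatrix b b (pCurvature p (eulerOp F K ^ n)) = nilpotentJordanBlock K n := by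
  have h0 := pCurvature_pow_mk_one_eq_zero p F K n
  have h1 := pCurvature_pow_mk_one_ne_zero p F K n
  -- Reversing the order gives bⱼ = ψⁿ⁻¹⁻ʲ(1), so ψ sends bⱼ to bⱼ₋₁ and the ones land above the
  -- diagonal.
  let b := (Module.Basis.mk (linearIndependent_pow_apply _ _ n h0 h1)
    (span_pCurvature_pow p F K n _ h0 h1).ge).reindex Fin.revPerm
  have hb : ∀ j : Fin n, b j = (pCurvature p (eulerOp F K ^ n) ^ (n - 1 - (j : ℕ)))
      (Submodule.Quotient.mk 1) := fun j => by
    simp only [b, Module.Basis.reindex_apply, Module.Basis.mk_apply, Fin.revPerm_symm,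
      Fin.revPerm_apply, Fin.val_rev]
    rw [show n - ((j : ℕ) + 1) = n - 1 - j by omega]
  refine ⟨b, Matrix.ext fun i j => ?_⟩
  rw [LinearMap.toMatrix_apply, hb, ← Module.End.mul_apply, ← pow_succ']
  have hj := j.isLt
  by_cases hj0 : (j : ℕ) = 0
  · rw [show n - 1 - (j : ℕ) + 1 = n by omega, h0]
    simp [nilpotentJordanBlock, hj0]
  · have hpred := hb ⟨j - 1, by omega⟩
    rw [show n - 1 - ((⟨j - 1, by omega⟩ : Fin n) : ℕ) = n - 1 - (j : ℕ) + 1 by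
      change n - 1 - ((j : ℕ) - 1) = _; omega] at hpred
    rw [← hpred, Module.Basis.repr_self, Finsupp.single_apply]
    simp only [nilpotentJordanBlock, Matrix.of_apply, Fin.ext_iff]
    congr 1
    apply propext
    omega

end euler

theorem mainTheorem11 (p : ℕ) [Fact p.Prime] (F : Type*) [Field F] [Finite F] [CharP F p]
    (K : Type*) [Field K] [Algebra (RatFunc F) K] [Algebra.IsSeparable (RatFunc F) K] (n : ℕ) :
    (eulerOp F K ^ n).Indecomposable ∧
      ∃ b : Module.Basis (Fin n) K (eulerOp F K ^ n).QuotMod,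
        LinearMap.toMatrix b b (pCurvature p (eulerOp F K ^ n)) = nilpotentJordanBlock K n :=
  ⟨indecomposable_eulerOp_pow p F K n, exists_basis_toMatrix_pCurvature p F K n⟩
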